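/- Let $d\ge 0$, let $\Omega\subset\mathbb R^d$ be a Borel set (for instance an open or a closed domain), let $|\cdot|$ be the Euclidean norm, and let $p\in[1,\infty)$. Let $\mathcal P(\Omega)$ be the set of Borel probability measures on $\Omega$, and for $\mu\in\mathcal P(\Omega)$ put $m_p(\mu)=\int_\Omega|x|^p\,d\mu(x)\in[0,\infty]$ and $\mathcal W_p(\Omega)=\{\mu\in\mathcal P(\Omega): m_p(\mu)<\infty\}$. For $\mu,\nu\in\mathcal P(\Omega)$ let $\Pi(\mu,\nu)$ be the set of Borel probability measures on $\Omega\times\Omega$ with first marginal $\mu$ and second marginal $\nu$, and $$W_p(\mu,\nu)=\Big(\min_{\gamma\in\Pi(\mu,\nu)}\int_{\Omega\times\Omega}|x-y|^p\,d\gamma(x,y)\Big)^{1/p}\in[0,\infty].$$ Then this minimum is attained for all $\mu,\nu\in\mathcal P(\Omega)$, and $W_p$ is a (finite) distance on $\mathcal W_p(\Omega)$. Moreover, for $\mu\in\mathcal W_p(\Omega)$ and a sequence $(\mu_n)_n$ in $\mathcal W_p(\Omega)$, the following are equivalent: (i) $W_p(\mu_n,\mu)\to0$; (ii) $\mu_n\rightharpoonup\mu$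 weakly (i.e. $\int_\Omega\phi\,d\mu_n\to\int_\Omega\phi\,d\mu$ for every bounded continuous $\phi:\Omega\to\mathbb R$) and $m_p(\mu_n)\to m_p(\mu)$; (iii) $\int_\Omega\phi\,d\mu_n\to\int_\Omega\phi\,d\mu$ for every continuous $\phi:\Omega\to\mathbb R$ for which there are constants $A,B$ with $|\phi(x)|\le A+B|x|^p$ for all $x\in\Omega$. -/

import Mathlib

open MeasureTheory Filter Topology
open scoped ENNReal

noncomputable section

namespace OptimalTransport

variable {d : ℕ} {Ω : Set (EuclideanSpace ℝ (Fin d))}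

/-- Transport plans `Π(μ, ν)`: probability measures on `Ω × Ω` with marginals `μ` and `ν`. -/
def transportPlans (μ ν : ProbabilityMeasure Ω) : Set (ProbabilityMeasure (Ω × Ω)) :=
  {γ | (γ : Measure (Ω × Ω)).map Prod.fst = (μ : Measure Ω) ∧
       (γ : Measure (Ω × Ω)).map Prod.snd = (ν : Measure Ω)}

/-- The cost `∫ |x - y| ^ p dγ` of a plan, in `[0, ∞]`. -/
def planCost (p : ℝ) (γ : ProbabilityMeasure (Ω × Ω)) : ℝ≥0∞ :=
  ∫⁻ z, ‖(z.1 : EuclideanSpace ℝ (Fin d)) - (z.2 : EuclideanSpace ℝ (Fin d))‖ₑ ^ p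
    ∂(γ : Measure (Ω × Ω))

/-- A plan solving the Kantorovich problem between `μ` and `ν` for the cost `|x - y| ^ p`. -/
def IsOptimalPlan (p : ℝ) (μ ν : ProbabilityMeasure Ω) (γ : ProbabilityMeasure (Ω × Ω)) : Prop :=
  γ ∈ transportPlans μ ν ∧ IsMinOn (planCost p) (transportPlans μ ν) γ

/-- `W_p(μ, ν)`, the `p`-th root of the value of the Kantorovich problem, in `[0, ∞]`. -/
def Wp (p : ℝ) (μ ν : ProbabilityMeasure Ω) : ℝ≥0∞ :=
  (⨅ γ ∈ transportPlans μ ν, planCost p γ) ^ (1 / p)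

/-- The `p`-th moment `m_p(μ) = ∫ |x| ^ p dμ`, in `[0, ∞]`. -/
def moment (p : ℝ) (μ : ProbabilityMeasure Ω) : ℝ≥0∞ :=
  ∫⁻ x, ‖(x : EuclideanSpace ℝ (Fin d))‖ₑ ^ p ∂(μ : Measure Ω)

/-- The probability measures on `Ω` with finite `p`-th moment. -/
def finiteMoment (p : ℝ) (Ω : Set (EuclideanSpace ℝ (Fin d))) : Set (ProbabilityMeasure Ω) :=
  {μ | moment p μ < ∞}

/-- `φ` has growth at most of order `p`. -/
def HasGrowth (p : ℝ) (φ : Ω → ℝ) : Prop :=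
  ∃ A B : ℝ, ∀ x : Ω, |φ x| ≤ A + B * ‖(x : EuclideanSpace ℝ (Fin d))‖ ^ p

end OptimalTransport

end

namespace OptimalTransport

open scoped NNReal

/-! A Borel probability measure on the Borel set `Ω` is tight, so plans with fixed marginals form a
weakly compact set by Prokhorov. The cost is lower semicontinuous, so the minimum is attained. The
value `Wp` is then the `L^p` norm of `x - y` under an optimal plan, and the metric axioms become
facts about `L^p` norms. The triangle inequality is Minkowski's inequality on a measure gluing two
plans along their common marginal (`exists_gluing`).

(i) ⇒ (ii): the root of the moment is the `L^p` norm of a coordinate, so it varies by at most `Wp`;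
bounded Lipschitz test functions give weak convergence.

(ii) ⇒ (iii): if `|φ| ≤ g = A + B|x|^p`, lower semicontinuity bounds the integrals of `g + φ` and `g
- φ` from below in the limit. Their sum converges, so neither can jump up.

(iii) ⇒ (i): a continuous partition of unity moves mass to finitely many points `e i`, at a cost at
most the integral of a continuous function `D` of growth `p`. By (iii) the bound for `μs n` tends to
the bound for `μ`, which is small for a fine net. The weights at the `e i` also converge, so the
quantized measures are close (`tendsto_Wp_quantize`). Two triangle inequalities conclude. -/

/-! ### Existence of optimal plans -/

/-- Integration of a nonnegative continuous function is lower semicontinuous for weak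
convergence. -/
theorem lowerSemicontinuous_lintegral {X : Type*} [TopologicalSpace X] [MeasurableSpace X]
    [OpensMeasurableSpace X] {f : X → ℝ≥0} (hf : Continuous f) :
    LowerSemicontinuous fun μ : ProbabilityMeasure X => ∫⁻ x, (f x : ℝ≥0∞) ∂(μ : Measure X) := by
  -- The truncations `min f n` are bounded and continuous, so their integrals are weakly continuous;
  -- a supremum of continuous functions is lower semicontinuous.
  have key : (fun μ : ProbabilityMeasure X => ∫⁻ x, (f x : ℝ≥0∞) ∂(μ : Measure X)) =
      fun μ : ProbabilityMeasure X => ⨆ n : ℕ, ∫⁻ x, ((min (f x) n : ℝ≥0) : ℝ≥0∞) ∂(μ : Measure X) := by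
    funext μ
    rw [← lintegral_iSup]
    · refine lintegral_congr fun x => le_antisymm ?_ ?_
      · obtain ⟨n, hn⟩ := exists_nat_ge (f x)
        exact le_iSup_of_le n (by rw [min_eq_left hn])
      · exact iSup_le fun n => by exact_mod_cast min_le_left _ _
    · exact fun n => (hf.min continuous_const).measurable.coe_nnreal_ennreal
    · intro m n hmn x
      dsimp only
      gcongr
  rw [key]
  refine lowerSemicontinuous_iSup fun n => Continuous.lowerSemicontinuous ?_
  let g : BoundedContinuousFunction X ℝ≥0 :=
    BoundedContinuousFunction.mkOfBound ⟨fun x => min (f x) n, hf.min continuous_const⟩ n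
      fun x y => by
        rw [NNReal.dist_eq, abs_le]
        have h1 : ((min (f x) n : ℝ≥0) : ℝ) ≤ n := by exact_mod_cast min_le_right _ _
        have h2 : ((min (f y) n : ℝ≥0) : ℝ) ≤ n := by exact_mod_cast min_le_right _ _
        have h3 := (min (f x) (n : ℝ≥0)).coe_nonneg
        have h4 := (min (f y) (n : ℝ≥0)).coe_nonneg
        constructor <;> simp only [ContinuousMap.coe_mk] <;> linarith
  exact continuous_iff_continuousAt.2 fun μ =>
    ProbabilityMeasure.tendsto_iff_forall_lintegral_tendsto.1 (continuous_id.tendsto μ) g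

variable {d : ℕ} {Ω : Set (EuclideanSpace ℝ (Fin d))} {p : ℝ}

/-- Since `Ω` is Borel, Borel subsets of `Ω` are Borel in the Euclidean space. The compact sets that
inner regularity provides there lie inside `Ω` and remain compact in it. -/
theorem isTightMeasureSet_singleton_of_measurableSet (hΩ : MeasurableSet Ω)
    (μ : ProbabilityMeasure Ω) : IsTightMeasureSet {(μ : Measure Ω)} := by
  refine isTightMeasureSet_singleton_of_innerRegularWRT ?_
  intro s hs r hr
  have hs' : MeasurableSet ((↑) '' s : Set (EuclideanSpace ℝ (Fin d))) := hΩ.subtype_image hs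
  have : IsFiniteMeasure ((μ : Measure Ω).map Subtype.val) := inferInstance
  have hpre : (Subtype.val ⁻¹' (Subtype.val '' s) : Set Ω) = s :=
    Set.preimage_image_eq _ Subtype.val_injective
  obtain ⟨K, hKs, ⟨hK, -⟩, hrK⟩ := innerRegular_isCompact_isClosed_measurableSet_of_finite
    ((μ : Measure Ω).map Subtype.val) hs' r
      (by rwa [Measure.map_apply measurable_subtype_coe hs', hpre])
  have hKΩ : K ⊆ Set.range (Subtype.val : Ω → EuclideanSpace ℝ (Fin d)) :=
    hKs.trans (Set.image_subset_range _ _)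
  have hc : IsCompact (Subtype.val ⁻¹' K : Set Ω) :=
    (Topology.IsInducing.subtypeVal).isCompact_preimage' hK hKΩ
  refine ⟨Subtype.val ⁻¹' K, ?_, ⟨hc, hc.isClosed⟩, ?_⟩
  · exact (Set.preimage_mono hKs).trans hpre.subset
  · rwa [Measure.map_apply measurable_subtype_coe hK.measurableSet] at hrK

/-- Tight marginals make the plans tight, so Prokhorov's theorem applies; the marginal conditions
are closed because pushforward by a continuous map is weakly continuous. -/
theorem isCompact_transportPlans (hΩ : MeasurableSet Ω) (μ ν : ProbabilityMeasure Ω) :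
    IsCompact (transportPlans μ ν) := by
  have hclosed : IsClosed (transportPlans μ ν) := by
    have h1 : IsClosed {γ : ProbabilityMeasure (Ω × Ω) |
        γ.map measurable_fst.aemeasurable = μ} :=
      isClosed_eq (ProbabilityMeasure.continuous_map continuous_fst) continuous_const
    have h2 : IsClosed {γ : ProbabilityMeasure (Ω × Ω) |
        γ.map measurable_snd.aemeasurable = ν} :=
      isClosed_eq (ProbabilityMeasure.continuous_map continuous_snd) continuous_const
    convert! h1.inter h2 using 1
    ext γ
    exact and_congr (Subtype.ext_iff (a1 := γ.map measurable_fst.aemeasurable)).symm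
      (Subtype.ext_iff (a1 := γ.map measurable_snd.aemeasurable)).symm
  rw [← hclosed.closure_eq]
  refine isCompact_closure_of_isTightMeasureSet (IsTightMeasureSet.prodMk ?_ ?_)
  · refine (isTightMeasureSet_singleton_of_measurableSet hΩ μ).subset ?_
    rintro _ ⟨_, ⟨γ, hγ, rfl⟩, rfl⟩
    exact hγ.1
  · refine (isTightMeasureSet_singleton_of_measurableSet hΩ ν).subset ?_
    rintro _ ⟨_, ⟨γ, hγ, rfl⟩, rfl⟩
    exact hγ.2

theorem prod_mem_transportPlans (μ ν : ProbabilityMeasure Ω) : μ.prod ν ∈ transportPlans μ ν := by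
  constructor <;> simp

theorem lowerSemicontinuous_planCost (hp : 0 ≤ p) :
    LowerSemicontinuous (planCost p : ProbabilityMeasure (Ω × Ω) → ℝ≥0∞) := by
  have h := lowerSemicontinuous_lintegral (X := Ω × Ω)
    (f := fun z => ‖(z.1 : EuclideanSpace ℝ (Fin d)) - z.2‖₊ ^ p)
    ((NNReal.continuous_rpow_const hp).comp (by fun_prop))
  convert! h using 3
  refine lintegral_congr fun z => ?_
  exact (ENNReal.coe_rpow_of_nonneg _ hp).symm

theorem exists_isOptimalPlan (hΩ : MeasurableSet Ω) (hp : 0 ≤ p) (μ ν : ProbabilityMeasure Ω) :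
    ∃ γ, IsOptimalPlan p μ ν γ := by
  obtain ⟨γ, h1, h2⟩ := LowerSemicontinuousOn.exists_isMinOn ⟨_, prod_mem_transportPlans μ ν⟩
    (isCompact_transportPlans hΩ μ ν) ((lowerSemicontinuous_planCost hp).lowerSemicontinuousOn _)
  exact ⟨γ, h1, h2⟩

/-! ### The distance axioms -/

open ProbabilityTheory

theorem lintegral_enorm_rpow_eq_eLpNorm {α F : Type*} [MeasurableSpace α] [NormedAddCommGroup F]
    (hp : 0 < p) (f : α → F) (μ : Measure α) :
    (∫⁻ a, ‖f a‖ₑ ^ p ∂μ) ^ (1 / p) = eLpNorm f (ENNReal.ofReal p) μ := by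
  rw [eLpNorm_eq_lintegral_rpow_enorm_toReal (by simpa using hp) ENNReal.ofReal_ne_top,
    ENNReal.toReal_ofReal hp.le]

theorem isProbabilityMeasure_of_map_fst {γ : Measure (Ω × Ω)} {μ : ProbabilityMeasure Ω}
    (h : γ.map Prod.fst = μ) : IsProbabilityMeasure γ := by
  have : IsProbabilityMeasure (γ.map Prod.fst) := h ▸ inferInstance
  exact Measure.isProbabilityMeasure_of_map (f := Prod.fst)

/-- Competitors are plain measures, so they can be built as sums and pushforwards; a marginal
condition already forces total mass one. -/
theorem Wp_le_lintegral_rpow (hp : 0 < p) {μ ν : ProbabilityMeasure Ω} {γ : Measure (Ω × Ω)}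
    (h1 : γ.map Prod.fst = μ) (h2 : γ.map Prod.snd = ν) :
    Wp p μ ν ≤ (∫⁻ z, ‖(z.1 : EuclideanSpace ℝ (Fin d)) - z.2‖ₑ ^ p ∂γ) ^ (1 / p) := by
  have := isProbabilityMeasure_of_map_fst h1
  have hγ : (⟨γ, this⟩ : ProbabilityMeasure (Ω × Ω)) ∈ transportPlans μ ν := ⟨h1, h2⟩
  exact ENNReal.rpow_le_rpow (iInf₂_le _ hγ) (by positivity)

theorem Wp_le_eLpNorm (hp : 0 < p) {μ ν : ProbabilityMeasure Ω} {γ : Measure (Ω × Ω)}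
    (h1 : γ.map Prod.fst = μ) (h2 : γ.map Prod.snd = ν) :
    Wp p μ ν ≤ eLpNorm (fun z => (z.1 : EuclideanSpace ℝ (Fin d)) - z.2) (ENNReal.ofReal p) γ :=
  (Wp_le_lintegral_rpow hp h1 h2).trans_eq (lintegral_enorm_rpow_eq_eLpNorm hp _ _)

theorem IsOptimalPlan.Wp_eq (hp : 0 < p) {μ ν : ProbabilityMeasure Ω}
    {γ : ProbabilityMeasure (Ω × Ω)} (h : IsOptimalPlan p μ ν γ) :
    Wp p μ ν = eLpNorm (fun z => (z.1 : EuclideanSpace ℝ (Fin d)) - z.2) (ENNReal.ofReal p)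
      (γ : Measure (Ω × Ω)) := by
  refine (Wp_le_eLpNorm hp h.1.1 h.1.2).antisymm ?_
  rw [← lintegral_enorm_rpow_eq_eLpNorm hp]
  exact ENNReal.rpow_le_rpow (le_iInf₂ fun γ' hγ' => h.2 hγ') (by positivity)

theorem moment_rpow_eq (hp : 0 < p) (μ : ProbabilityMeasure Ω) :
    moment p μ ^ (1 / p) = eLpNorm (Subtype.val : Ω → EuclideanSpace ℝ (Fin d))
      (ENNReal.ofReal p) (μ : Measure Ω) :=
  lintegral_enorm_rpow_eq_eLpNorm hp _ _

theorem eLpNorm_val_comp {α : Type*} [MeasurableSpace α] {γ : Measure α}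
    {μ : Measure Ω} {f : α → Ω} (hf : Measurable f) (h : γ.map f = μ) (q : ℝ≥0∞) :
    eLpNorm (fun z => (f z : EuclideanSpace ℝ (Fin d))) q γ =
      eLpNorm (Subtype.val : Ω → EuclideanSpace ℝ (Fin d)) q μ := by
  rw [← h, eLpNorm_map_measure (by fun_prop) hf.aemeasurable]
  rfl

theorem Wp_lt_top (hp : 1 ≤ p) {μ ν : ProbabilityMeasure Ω} (hμ : moment p μ < ∞)
    (hν : moment p ν < ∞) : Wp p μ ν < ∞ := by
  have hp0 : 0 < p := by linarith
  have hpl := prod_mem_transportPlans μ ν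
  refine (Wp_le_eLpNorm hp0 hpl.1 hpl.2).trans_lt ?_
  refine (eLpNorm_sub_le (f := fun z : Ω × Ω => (z.1 : EuclideanSpace ℝ (Fin d)))
    (g := fun z => z.2) (by fun_prop) (by fun_prop) (by simpa using hp)).trans_lt ?_
  rw [eLpNorm_val_comp measurable_fst hpl.1, eLpNorm_val_comp measurable_snd hpl.2,
    ← moment_rpow_eq hp0, ← moment_rpow_eq hp0]
  exact ENNReal.add_lt_top.2 ⟨ENNReal.rpow_lt_top_of_nonneg (by positivity) hμ.ne,
    ENNReal.rpow_lt_top_of_nonneg (by positivity) hν.ne⟩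

theorem Wp_comm (hp : 0 < p) (hΩ : MeasurableSet Ω) (μ ν : ProbabilityMeasure Ω) :
    Wp p μ ν = Wp p ν μ := by
  suffices h : ∀ μ ν : ProbabilityMeasure Ω, Wp p μ ν ≤ Wp p ν μ from (h _ _).antisymm (h _ _)
  intro μ ν
  obtain ⟨γ, hγ⟩ := exists_isOptimalPlan hΩ hp.le ν μ
  rw [hγ.Wp_eq hp]
  refine (Wp_le_eLpNorm hp (γ := (γ : Measure (Ω × Ω)).map Prod.swap) ?_ ?_).trans_eq ?_
  · rw [Measure.map_map measurable_fst measurable_swap]; exact hγ.1.2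
  · rw [Measure.map_map measurable_snd measurable_swap]; exact hγ.1.1
  · rw [eLpNorm_map_measure (by fun_prop) (by fun_prop)]
    exact eLpNorm_sub_comm _ _ _ _

theorem Wp_self (hp : 0 < p) (μ : ProbabilityMeasure Ω) : Wp p μ μ = 0 := by
  have hd : Measurable fun x : Ω => (x, x) := by fun_prop
  refine le_antisymm ((Wp_le_eLpNorm hp
    (γ := (μ : Measure Ω).map fun x => (x, x)) ?_ ?_).trans_eq ?_) zero_le
  · rw [Measure.map_map measurable_fst hd]; exact Measure.map_id
  · rw [Measure.map_map measurable_snd hd]; exact Measure.map_id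
  · rw [eLpNorm_map_measure (by fun_prop) (by fun_prop)]
    simp [Function.comp_def]

/-- An optimal plan of zero cost is concentrated on the diagonal, where the two projections agree.
-/
theorem eq_of_Wp_eq_zero (hp : 0 < p) (hΩ : MeasurableSet Ω) {μ ν : ProbabilityMeasure Ω}
    (h : Wp p μ ν = 0) : μ = ν := by
  obtain ⟨γ, hγ⟩ := exists_isOptimalPlan hΩ hp.le μ ν
  rw [hγ.Wp_eq hp, eLpNorm_eq_zero_iff (by fun_prop) (by simpa using hp)] at h
  apply Subtype.ext
  change (μ : Measure Ω) = ν
  rw [← hγ.1.1, ← hγ.1.2]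
  refine Measure.map_congr ?_
  filter_upwards [h] with z hz
  exact Subtype.ext (sub_eq_zero.1 hz)

/-- Disintegrate both plans over the shared marginal `ν` and make the outer points conditionally
independent given the middle one. The coordinates of `Γ` are (middle, left, right), hence the swap
of `γ₁`. -/
theorem exists_gluing (hΩ : MeasurableSet Ω) {μ ν ρ : ProbabilityMeasure Ω}
    {γ₁ γ₂ : ProbabilityMeasure (Ω × Ω)} (h₁ : γ₁ ∈ transportPlans μ ν)
    (h₂ : γ₂ ∈ transportPlans ν ρ) :
    ∃ Γ : Measure (Ω × Ω × Ω), Γ.map (fun z => (z.2.1, z.1)) = γ₁ ∧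
      Γ.map (fun z => (z.1, z.2.2)) = γ₂ := by
  have := hΩ.standardBorel
  have : Nonempty Ω := μ.nonempty
  set γ₁' : Measure (Ω × Ω) := (γ₁ : Measure (Ω × Ω)).map Prod.swap with hγ₁'
  have hf₁ : γ₁'.fst = (ν : Measure Ω) := by
    rw [Measure.fst, Measure.map_map measurable_fst measurable_swap]; exact h₁.2
  have hf₂ : (γ₂ : Measure (Ω × Ω)).fst = (ν : Measure Ω) := h₂.1
  have : IsProbabilityMeasure γ₁' :=
    Measure.isProbabilityMeasure_map measurable_swap.aemeasurable
  have hd₁ := γ₁'.disintegrate γ₁'.condKernel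
  have hd₂ := (γ₂ : Measure (Ω × Ω)).disintegrate (γ₂ : Measure (Ω × Ω)).condKernel
  rw [hf₁] at hd₁
  rw [hf₂] at hd₂
  set κ₁ := γ₁'.condKernel
  set κ₂ := (γ₂ : Measure (Ω × Ω)).condKernel
  refine ⟨(ν : Measure Ω) ⊗ₘ (κ₁ ×ₖ κ₂), ?_, ?_⟩
  · have h : ((ν : Measure Ω) ⊗ₘ (κ₁ ×ₖ κ₂)).map (Prod.map id Prod.fst) = γ₁' := by
      rw [← Measure.compProd_map measurable_fst, ← Kernel.fst_eq, Kernel.fst_prod, hd₁]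
    have h' := congrArg (Measure.map Prod.swap) h
    rw [Measure.map_map measurable_swap (by fun_prop), hγ₁',
      Measure.map_map measurable_swap measurable_swap, Prod.swap_swap_eq, Measure.map_id] at h'
    exact h'
  · have h : ((ν : Measure Ω) ⊗ₘ (κ₁ ×ₖ κ₂)).map (Prod.map id Prod.snd) = γ₂ := by
      rw [← Measure.compProd_map measurable_snd, ← Kernel.snd_eq, Kernel.snd_prod, hd₂]
    exact h

theorem Wp_triangle (hp : 1 ≤ p) (hΩ : MeasurableSet Ω) (μ ν ρ : ProbabilityMeasure Ω) :
    Wp p μ ρ ≤ Wp p μ ν + Wp p ν ρ := by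
  have hp0 : 0 < p := by linarith
  obtain ⟨γ₁, h₁⟩ := exists_isOptimalPlan hΩ hp0.le μ ν
  obtain ⟨γ₂, h₂⟩ := exists_isOptimalPlan hΩ hp0.le ν ρ
  obtain ⟨Γ, hΓ₁, hΓ₂⟩ := exists_gluing hΩ h₁.1 h₂.1
  rw [h₁.Wp_eq hp0, h₂.Wp_eq hp0, ← hΓ₁, ← hΓ₂, eLpNorm_map_measure (by fun_prop) (by fun_prop),
    eLpNorm_map_measure (by fun_prop) (by fun_prop)]
  refine (Wp_le_eLpNorm hp0 (γ := Γ.map Prod.snd) ?_ ?_).trans ?_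
  · rw [← h₁.1.1, ← hΓ₁, Measure.map_map (by fun_prop) (by fun_prop),
      Measure.map_map (by fun_prop) (by fun_prop)]
    rfl
  · rw [← h₂.1.2, ← hΓ₂, Measure.map_map (by fun_prop) (by fun_prop),
      Measure.map_map (by fun_prop) (by fun_prop)]
    rfl
  · rw [eLpNorm_map_measure (by fun_prop) (by fun_prop)]
    refine le_trans (le_of_eq ?_) (eLpNorm_add_le (by fun_prop) (by fun_prop) (by simpa using hp))
    congr 1
    funext z
    simp

/-! ### From Wasserstein convergence to weak convergence and moments -/

/-- Minkowski's inequality for `x = (x - y) + y` under an optimal plan. The origin need not lie in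
`Ω`, so this is not an instance of the triangle inequality with a Dirac mass. -/
theorem moment_rpow_le (hp : 1 ≤ p) (hΩ : MeasurableSet Ω) (μ ν : ProbabilityMeasure Ω) :
    moment p μ ^ (1 / p) ≤ Wp p μ ν + moment p ν ^ (1 / p) := by
  have hp0 : 0 < p := by linarith
  obtain ⟨γ, hγ⟩ := exists_isOptimalPlan hΩ hp0.le μ ν
  rw [hγ.Wp_eq hp0, moment_rpow_eq hp0, moment_rpow_eq hp0,
    ← eLpNorm_val_comp measurable_fst hγ.1.1, ← eLpNorm_val_comp measurable_snd hγ.1.2]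
  refine le_trans (le_of_eq ?_) (eLpNorm_add_le (by fun_prop) (by fun_prop) (by simpa using hp))
  congr 1
  funext z
  simp

theorem tendsto_moment_of_tendsto_Wp (hp : 1 ≤ p) (hΩ : MeasurableSet Ω)
    {μ : ProbabilityMeasure Ω} {μs : ℕ → ProbabilityMeasure Ω}
    (h : Tendsto (fun n => Wp p (μs n) μ) atTop (𝓝 0)) :
    Tendsto (fun n => moment p (μs n)) atTop (𝓝 (moment p μ)) := by
  have hp0 : 0 < p := by linarith
  have hroot : Tendsto (fun n => moment p (μs n) ^ (1 / p)) atTop (𝓝 (moment p μ ^ (1 / p))) := by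
    -- With truncated subtraction in `[0, ∞]`, the two-sided bound needs no finiteness of the
    -- moments.
    have hlow : Tendsto (fun n => moment p μ ^ (1 / p) - Wp p (μs n) μ) atTop
        (𝓝 (moment p μ ^ (1 / p))) := by
      simpa using ENNReal.Tendsto.sub tendsto_const_nhds h (Or.inr ENNReal.zero_ne_top)
    have hup : Tendsto (fun n => Wp p (μs n) μ + moment p μ ^ (1 / p)) atTop
        (𝓝 (moment p μ ^ (1 / p))) := by
      simpa using h.add tendsto_const_nhds
    refine tendsto_of_tendsto_of_tendsto_of_le_of_le hlow hup (fun n => ?_)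
      fun n => moment_rpow_le hp hΩ _ _
    rw [tsub_le_iff_left, Wp_comm hp0 hΩ]
    exact moment_rpow_le hp hΩ _ _
  have := ((ENNReal.continuous_rpow_const (y := p)).tendsto _).comp hroot
  simpa [Function.comp_def, ← ENNReal.rpow_mul, hp0.ne'] using this

/-- Bounded Lipschitz functions suffice for weak convergence. Under an optimal plan the two
integrals of a `K`-Lipschitz function differ by at most `K` times the `L^1` norm of `x - y`, which
is at most its `L^p` norm. -/
theorem tendsto_of_tendsto_Wp (hp : 1 ≤ p) (hΩ : MeasurableSet Ω)
    {μ : ProbabilityMeasure Ω} {μs : ℕ → ProbabilityMeasure Ω}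
    (h : Tendsto (fun n => Wp p (μs n) μ) atTop (𝓝 0)) : Tendsto μs atTop (𝓝 μ) := by
  have hp0 : 0 < p := by linarith
  rw [tendsto_iff_forall_lipschitz_integral_tendsto]
  rintro f ⟨C, hC⟩ ⟨K, hK⟩
  have hint : ∀ γ : ProbabilityMeasure (Ω × Ω), ∀ g : Ω × Ω → Ω, Measurable g →
      Integrable (fun z => f (g z)) (γ : Measure (Ω × Ω)) := by
    intro γ g hg
    obtain ⟨x₀⟩ : Nonempty Ω := μ.nonempty
    refine Integrable.of_bound (hK.continuous.measurable.comp hg).aestronglyMeasurable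
      (C + ‖f x₀‖) (Eventually.of_forall fun z => ?_)
    have h1 := hC (g z) x₀
    rw [dist_eq_norm] at h1
    have h2 := norm_add_le (f (g z) - f x₀) (f x₀)
    rw [sub_add_cancel] at h2
    linarith
  rw [tendsto_iff_edist_tendsto_0]
  have hK0 : Tendsto (fun n => (K : ℝ≥0∞) * Wp p (μs n) μ) atTop (𝓝 0) := by
    simpa using ENNReal.Tendsto.const_mul h (Or.inr ENNReal.coe_ne_top)
  refine tendsto_of_tendsto_of_tendsto_of_le_of_le tendsto_const_nhds hK0
    (fun _ => zero_le) fun n => ?_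
  obtain ⟨γ, hγ⟩ := exists_isOptimalPlan hΩ hp0.le (μs n) μ
  rw [hγ.Wp_eq hp0, ← hγ.1.1, ← hγ.1.2,
    integral_map (by fun_prop) hK.continuous.aestronglyMeasurable,
    integral_map (by fun_prop) hK.continuous.aestronglyMeasurable, edist_eq_enorm_sub,
    ← integral_sub (hint _ _ measurable_fst) (hint _ _ measurable_snd)]
  refine (enorm_integral_le_lintegral_enorm _).trans ?_
  calc ∫⁻ z, ‖f z.1 - f z.2‖ₑ ∂(γ : Measure (Ω × Ω))
      ≤ ∫⁻ z, K * ‖(z.1 : EuclideanSpace ℝ (Fin d)) - z.2‖ₑ ∂(γ : Measure (Ω × Ω)) := by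
        refine lintegral_mono fun z => ?_
        rw [← edist_eq_enorm_sub, ← edist_eq_enorm_sub]
        exact hK z.1 z.2
    _ = K * eLpNorm (fun z : Ω × Ω => (z.1 : EuclideanSpace ℝ (Fin d)) - z.2) 1 γ := by
        rw [lintegral_const_mul _ (by fun_prop), eLpNorm_one_eq_lintegral_enorm]
    _ ≤ _ := by
        gcongr
        exact eLpNorm_le_eLpNorm_of_exponent_le (by simpa using hp) (by fun_prop)

/-! ### From weak convergence and moments to test functions of growth `p` -/

/-- The lower bound on `b n` leaves at most about `α` for `a n` in a sum close to `α + β`. -/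
theorem tendsto_of_add_tendsto {a b : ℕ → ℝ≥0∞} {α β : ℝ≥0∞} (ha : ∀ y < α, ∀ᶠ n in atTop, y < a n)
    (hb : ∀ y < β, ∀ᶠ n in atTop, y < b n)
    (hab : Tendsto (fun n => a n + b n) atTop (𝓝 (α + β))) (hfin : α + β ≠ ∞) :
    Tendsto a atTop (𝓝 α) := by
  obtain ⟨hα, hβ⟩ := ENNReal.add_ne_top.1 hfin
  have low : ∀ {c : ℕ → ℝ≥0∞} {y : ℝ≥0∞}, y ≠ ∞ → (∀ x < y, ∀ᶠ n in atTop, x < c n) →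
      ∀ ε > 0, ∀ᶠ n in atTop, y - ε ≤ c n := by
    intro c y hy hc ε hε
    rcases eq_or_ne y 0 with rfl | hy0
    · simp
    · exact (hc _ (ENNReal.sub_lt_self hy hy0 hε.ne')).mono fun n hn => hn.le
  rw [ENNReal.tendsto_nhds hα]
  intro ε hε
  have hε2 : 0 < ε / 2 := ENNReal.half_pos hε.ne'
  filter_upwards [low hα ha ε hε, low hβ hb _ hε2, (ENNReal.tendsto_nhds hfin).1 hab _ hε2]
    with n h1 h2 h3
  refine ⟨h1, ?_⟩
  rw [tsub_le_iff_right] at h2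
  have h4 : a n + β ≤ α + ε + β := calc
    a n + β ≤ a n + (b n + ε / 2) := by gcongr
    _ = (a n + b n) + ε / 2 := by ring
    _ ≤ (α + β + ε / 2) + ε / 2 := add_le_add_left h3.2 _
    _ = α + β + (ε / 2 + ε / 2) := by ring
    _ = α + ε + β := by rw [ENNReal.add_halves]; ring
  exact (ENNReal.add_le_add_iff_right hβ).1 h4

theorem HasGrowth.exists_nonneg {φ : Ω → ℝ} (hφ : HasGrowth p φ) :
    ∃ A B : ℝ, 0 ≤ A ∧ 0 ≤ B ∧
      ∀ x : Ω, |φ x| ≤ A + B * ‖(x : EuclideanSpace ℝ (Fin d))‖ ^ p := by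
  obtain ⟨A, B, h⟩ := hφ
  refine ⟨|A|, |B|, abs_nonneg _, abs_nonneg _, fun x => (h x).trans ?_⟩
  gcongr <;> exact le_abs_self _

theorem lintegral_growth (hp : 0 ≤ p) {A B : ℝ} (hA : 0 ≤ A) (hB : 0 ≤ B)
    (μ : ProbabilityMeasure Ω) :
    ∫⁻ x, ENNReal.ofReal (A + B * ‖(x : EuclideanSpace ℝ (Fin d))‖ ^ p) ∂(μ : Measure Ω) =
      ENNReal.ofReal A + ENNReal.ofReal B * moment p μ := by
  have h : ∀ x : Ω, ENNReal.ofReal (A + B * ‖(x : EuclideanSpace ℝ (Fin d))‖ ^ p) =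
      ENNReal.ofReal A + ENNReal.ofReal B * ‖(x : EuclideanSpace ℝ (Fin d))‖ₑ ^ p := by
    intro x
    rw [ENNReal.ofReal_add hA (by positivity), ENNReal.ofReal_mul hB,
      ← ENNReal.ofReal_rpow_of_nonneg (norm_nonneg _) hp, ofReal_norm]
  simp_rw [h]
  rw [lintegral_add_left measurable_const, lintegral_const_mul _ (by fun_prop), moment]
  simp

theorem HasGrowth.integrable (hp : 0 ≤ p) {φ : Ω → ℝ} (hc : Continuous φ) (hφ : HasGrowth p φ)
    {μ : ProbabilityMeasure Ω} (hμ : moment p μ < ∞) : Integrable φ (μ : Measure Ω) := by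
  obtain ⟨A, B, hA, hB, h⟩ := hφ.exists_nonneg
  refine ⟨hc.aestronglyMeasurable, ?_⟩
  calc ∫⁻ x, ‖φ x‖ₑ ∂(μ : Measure Ω)
      ≤ ∫⁻ x, ENNReal.ofReal (A + B * ‖(x : EuclideanSpace ℝ (Fin d))‖ ^ p) ∂(μ : Measure Ω) := by
        refine lintegral_mono fun x => ?_
        rw [← ofReal_norm]
        exact ENNReal.ofReal_le_ofReal (h x)
    _ < ∞ := by
        rw [lintegral_growth hp hA hB]
        exact ENNReal.add_lt_top.2 ⟨ENNReal.ofReal_lt_top,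
          ENNReal.mul_lt_top ENNReal.ofReal_lt_top hμ⟩

theorem tendsto_integral_of_hasGrowth (hp : 0 ≤ p) {μ : ProbabilityMeasure Ω}
    {μs : ℕ → ProbabilityMeasure Ω} (hμ : moment p μ < ∞) (hμs : ∀ n, moment p (μs n) < ∞)
    (hw : Tendsto μs atTop (𝓝 μ))
    (hm : Tendsto (fun n => moment p (μs n)) atTop (𝓝 (moment p μ)))
    {φ : Ω → ℝ} (hc : Continuous φ) (hφ : HasGrowth p φ) :
    Tendsto (fun n => ∫ x, φ x ∂(μs n : Measure Ω)) atTop (𝓝 (∫ x, φ x ∂(μ : Measure Ω))) := by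
  obtain ⟨A, B, hA, hB, h⟩ := hφ.exists_nonneg
  set g : Ω → ℝ := fun x => A + B * ‖(x : EuclideanSpace ℝ (Fin d))‖ ^ p with hg
  have hgc : Continuous g := by
    have : Continuous fun x : Ω => ‖(x : EuclideanSpace ℝ (Fin d))‖ ^ p :=
      (continuous_norm.comp continuous_subtype_val).rpow_const fun _ => Or.inr hp
    fun_prop
  have hg0 : ∀ x, 0 ≤ g x := fun x => by positivity
  have hgG : HasGrowth p g := ⟨A, B, fun x => by rw [abs_of_nonneg (hg0 x)]⟩
  have hplus : ∀ x, 0 ≤ g x + φ x := fun x => by linarith [(abs_le.1 (h x)).1]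
  have hminus : ∀ x, 0 ≤ g x - φ x := fun x => by linarith [(abs_le.1 (h x)).2]
  have hgt : Tendsto (fun n => ∫⁻ x, ENNReal.ofReal (g x) ∂(μs n : Measure Ω)) atTop
      (𝓝 (∫⁻ x, ENNReal.ofReal (g x) ∂(μ : Measure Ω))) := by
    simp_rw [hg, lintegral_growth hp hA hB]
    exact tendsto_const_nhds.add (ENNReal.Tendsto.const_mul hm (Or.inr ENNReal.ofReal_ne_top))
  have hgfin : ∫⁻ x, ENNReal.ofReal (g x) ∂(μ : Measure Ω) ≠ ∞ := by
    rw [hg, lintegral_growth hp hA hB]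
    exact ENNReal.add_ne_top.2 ⟨ENNReal.ofReal_ne_top,
      ENNReal.mul_ne_top ENNReal.ofReal_ne_top hμ.ne⟩
  have hsum : ∀ ν : ProbabilityMeasure Ω, ∫⁻ x, ENNReal.ofReal (g x + φ x) ∂(ν : Measure Ω) +
      ∫⁻ x, ENNReal.ofReal (g x - φ x) ∂(ν : Measure Ω) =
      2 * ∫⁻ x, ENNReal.ofReal (g x) ∂(ν : Measure Ω) := by
    intro ν
    rw [← lintegral_add_left (by fun_prop), ← lintegral_const_mul _ (by fun_prop)]
    refine lintegral_congr fun x => ?_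
    rw [← ENNReal.ofReal_add (hplus x) (hminus x), ← ENNReal.ofReal_ofNat,
      ← ENNReal.ofReal_mul (by norm_num)]
    congr 1
    ring
  have hsumfin : ∫⁻ x, ENNReal.ofReal (g x + φ x) ∂(μ : Measure Ω) +
      ∫⁻ x, ENNReal.ofReal (g x - φ x) ∂(μ : Measure Ω) ≠ ∞ := by
    rw [hsum]
    exact ENNReal.mul_ne_top ENNReal.ofNat_ne_top hgfin
  have hut : Tendsto (fun n => ∫⁻ x, ENNReal.ofReal (g x + φ x) ∂(μs n : Measure Ω)) atTop
      (𝓝 (∫⁻ x, ENNReal.ofReal (g x + φ x) ∂(μ : Measure Ω))) := by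
    refine tendsto_of_add_tendsto
      (b := fun n => ∫⁻ x, ENNReal.ofReal (g x - φ x) ∂(μs n : Measure Ω))
      (fun y hy => ?_) (fun y hy => ?_) ?_ hsumfin
    · exact hw.eventually (lowerSemicontinuous_lintegral
        (f := fun x => (g x + φ x).toNNReal) (by fun_prop) μ y hy)
    · exact hw.eventually (lowerSemicontinuous_lintegral
        (f := fun x => (g x - φ x).toNNReal) (by fun_prop) μ y hy)
    · simp_rw [hsum]
      exact ENNReal.Tendsto.const_mul hgt (Or.inr ENNReal.ofNat_ne_top)
  -- Finite moments allow `φ` to be recovered as `(g + φ) - g`, both terms being nonnegative with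
  -- convergent integrals.
  have key : ∀ ν : ProbabilityMeasure Ω, moment p ν < ∞ → ∫ x, φ x ∂(ν : Measure Ω) =
      (∫⁻ x, ENNReal.ofReal (g x + φ x) ∂(ν : Measure Ω)).toReal -
        (∫⁻ x, ENNReal.ofReal (g x) ∂(ν : Measure Ω)).toReal := by
    intro ν hν
    rw [← integral_eq_lintegral_of_nonneg_ae (Eventually.of_forall hplus)
      (by fun_prop), ← integral_eq_lintegral_of_nonneg_ae (Eventually.of_forall hg0)
      (by fun_prop), integral_add (hgG.integrable hp hgc hν) (hφ.integrable hp hc hν)]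
    ring
  rw [key μ hμ]
  simp_rw [fun n => key (μs n) (hμs n)]
  exact ((ENNReal.tendsto_toReal (ENNReal.add_ne_top.1 hsumfin).1).comp hut).sub
    ((ENNReal.tendsto_toReal hgfin).comp hgt)

/-! ### Transport estimates and quantization on finitely many points -/

/-- If `ν` dominates `(1 - δ) μ`, then all but a fraction `δ` of the mass can stay in place. -/
theorem Wp_le_of_smul_le (hp : 0 < p) {μ ν : ProbabilityMeasure Ω} {δ C : ℝ≥0∞} (hδ : δ ≤ 1)
    (h : (1 - δ) • (μ : Measure Ω) ≤ ν)
    (hC : ∀ᵐ x : Ω ∂(μ : Measure Ω), ∀ᵐ y : Ω ∂(ν : Measure Ω),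
      ‖(x : EuclideanSpace ℝ (Fin d)) - y‖ₑ ^ p ≤ C) :
    Wp p μ ν ≤ (δ * C) ^ (1 / p) := by
  have hd : Measurable fun x : Ω => (x, x) := by fun_prop
  have hfin : IsFiniteMeasure ((1 - δ) • (μ : Measure Ω)) :=
    isFiniteMeasure_of_le (ν : Measure Ω) h
  set σ : Measure Ω := (ν : Measure Ω) - (1 - δ) • (μ : Measure Ω) with hσ
  have hσν : σ ≤ ν := Measure.sub_le
  have : IsFiniteMeasure σ := isFiniteMeasure_of_le (ν : Measure Ω) hσν
  have hσu : σ Set.univ = δ := by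
    rw [hσ, Measure.sub_apply MeasurableSet.univ h]
    simp [ENNReal.sub_sub_cancel ENNReal.one_ne_top hδ]
  -- The mass `(1 - δ) μ` stays on the diagonal at no cost, and the remainder is spread
  -- independently. As `σ` has mass `δ`, the first marginal is `(1 - δ) μ + δ μ` and the second is
  -- `(1 - δ) μ + σ = ν`.
  refine (Wp_le_lintegral_rpow hp (γ := (1 - δ) • (μ : Measure Ω).map (fun x => (x, x)) +
    (μ : Measure Ω).prod σ) ?_ ?_).trans ?_
  · rw [Measure.map_add _ _ measurable_fst, Measure.map_smul, Measure.map_map measurable_fst hd,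
      Measure.map_fst_prod, hσu, show Prod.fst ∘ (fun x : Ω => (x, x)) = id from rfl,
      Measure.map_id, ← add_smul, tsub_add_cancel_of_le hδ, one_smul]
  · rw [Measure.map_add _ _ measurable_snd, Measure.map_smul, Measure.map_map measurable_snd hd,
      Measure.map_snd_prod, show Prod.snd ∘ (fun x : Ω => (x, x)) = id from rfl,
      Measure.map_id, measure_univ, one_smul, add_comm, hσ, Measure.sub_add_cancel_of_le h]
  · refine ENNReal.rpow_le_rpow ?_ (by positivity)
    rw [lintegral_add_measure, lintegral_smul_measure, lintegral_map (by fun_prop) hd,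
      lintegral_prod _ (by fun_prop)]
    simp only [sub_self, enorm_zero, ENNReal.zero_rpow_of_pos hp, lintegral_zero, smul_zero,
      zero_add]
    calc ∫⁻ x, ∫⁻ y, ‖(x : EuclideanSpace ℝ (Fin d)) - y‖ₑ ^ p ∂σ ∂(μ : Measure Ω)
        ≤ ∫⁻ _, δ * C ∂(μ : Measure Ω) := by
          refine lintegral_mono_ae ?_
          filter_upwards [hC] with x hx
          refine (lintegral_mono_ae
            ((Measure.absolutelyContinuous_of_le hσν).ae_le hx)).trans_eq ?_
          rw [lintegral_const, hσu, mul_comm]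
      _ = δ * C := by simp

section Quantize

variable {ι : Type*} [Fintype ι]

/-- The image of `μ` under the Markov kernel `x ↦ ∑ i, χ i x • δ (e i)`. -/
noncomputable def quantize (χ : ι → Ω → ℝ≥0∞) (e : ι → Ω) (μ : Measure Ω) : Measure Ω :=
  ∑ i, (∫⁻ x, χ i x ∂μ) • Measure.dirac (e i)

variable {χ : ι → Ω → ℝ≥0∞} {e : ι → Ω}

theorem isProbabilityMeasure_quantize (hχ : ∀ i, Measurable (χ i)) (h1 : ∀ x, ∑ i, χ i x = 1)
    (e : ι → Ω) (μ : ProbabilityMeasure Ω) :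
    IsProbabilityMeasure (quantize χ e (μ : Measure Ω)) := by
  constructor
  simp [quantize, ← lintegral_finsetSum _ fun i _ => hχ i, h1]

/-- The plan sends the fraction `χ i x` of the mass at `x` to `e i`. Only indices with `χ i x ≠ 0`
contribute, each at unit cost at most `D x`. -/
theorem Wp_quantize_le (hp : 0 < p) (hχ : ∀ i, Measurable (χ i)) (h1 : ∀ x, ∑ i, χ i x = 1)
    {D : Ω → ℝ≥0∞} (hD : Measurable D)
    (hle : ∀ i x, χ i x ≠ 0 → ‖(x : EuclideanSpace ℝ (Fin d)) - e i‖ₑ ^ p ≤ D x)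
    {μ ν : ProbabilityMeasure Ω} (hν : (ν : Measure Ω) = quantize χ e μ) :
    Wp p μ ν ≤ (∫⁻ x, D x ∂(μ : Measure Ω)) ^ (1 / p) := by
  have hm : ∀ i, Measurable fun x : Ω => (x, e i) := fun i => by fun_prop
  refine (Wp_le_lintegral_rpow hp
    (γ := ∑ i, ((μ : Measure Ω).withDensity (χ i)).map fun x => (x, e i)) ?_ ?_).trans ?_
  · rw [Measure.map_finset_sum (by fun_prop)]
    ext s hs
    simp_rw [fun i => Measure.map_map measurable_fst (hm i) (μ := (μ : Measure Ω).withDensity (χ i)),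
      show ∀ i, Prod.fst ∘ (fun x : Ω => (x, e i)) = id from fun _ => rfl, Measure.map_id]
    rw [Measure.finsetSum_apply]
    simp_rw [withDensity_apply _ hs]
    rw [← lintegral_finsetSum _ fun i _ => hχ i]
    simp [h1]
  · rw [Measure.map_finset_sum (by fun_prop), hν, quantize]
    refine Finset.sum_congr rfl fun i _ => ?_
    rw [Measure.map_map measurable_snd (hm i)]
    refine (Measure.map_const _ _).trans ?_
    rw [withDensity_apply _ MeasurableSet.univ, Measure.restrict_univ]
  · refine ENNReal.rpow_le_rpow ?_ (by positivity)
    rw [lintegral_finsetSum_measure]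
    calc _ = ∑ i, ∫⁻ x, χ i x * ‖(x : EuclideanSpace ℝ (Fin d)) - e i‖ₑ ^ p ∂(μ : Measure Ω) := by
          refine Finset.sum_congr rfl fun i _ => ?_
          rw [lintegral_map (by fun_prop) (hm i),
            lintegral_withDensity_eq_lintegral_mul _ (hχ i) (by fun_prop)]
          rfl
      _ ≤ ∑ i, ∫⁻ x, χ i x * D x ∂(μ : Measure Ω) := by
          refine Finset.sum_le_sum fun i _ => lintegral_mono fun x => ?_
          rcases eq_or_ne (χ i x) 0 with h0 | h0
          · simp [h0]
          · exact mul_le_mul_right (hle i x h0) _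
      _ = ∫⁻ x, D x ∂(μ : Measure Ω) := by
          rw [← lintegral_finsetSum (f := fun i x => χ i x * D x) _ fun i _ => (hχ i).mul hD]
          simp_rw [← Finset.sum_mul, h1, one_mul]

theorem ae_quantize {P : Ω → Prop} (h : ∀ i, P (e i)) (μ : Measure Ω) :
    ∀ᵐ x ∂quantize χ e μ, P x := by
  rw [quantize, ae_iff, Measure.finsetSum_apply]
  refine Finset.sum_eq_zero fun i _ => ?_
  rw [Measure.smul_apply, smul_eq_mul]
  refine mul_eq_zero_of_right _ ?_
  rw [← ae_iff, ae_dirac_eq]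
  exact h i

/-- Convergence of the finitely many weights makes the `n`-th quantized measure eventually dominate
`(1 - δ) ν`; between the points `e i` the cost is bounded, so moving the remaining mass `δ` is
cheap. -/
theorem tendsto_Wp_quantize (hp : 0 < p) {μ : ProbabilityMeasure Ω}
    {μs : ℕ → ProbabilityMeasure Ω} {ν : ProbabilityMeasure Ω} {νs : ℕ → ProbabilityMeasure Ω}
    (hν : (ν : Measure Ω) = quantize χ e μ) (hνs : ∀ n, (νs n : Measure Ω) = quantize χ e (μs n))
    (hfin : ∀ i, ∫⁻ x, χ i x ∂(μ : Measure Ω) ≠ ∞)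
    (h : ∀ i, Tendsto (fun n => ∫⁻ x, χ i x ∂(μs n : Measure Ω)) atTop
      (𝓝 (∫⁻ x, χ i x ∂(μ : Measure Ω)))) :
    Tendsto (fun n => Wp p ν (νs n)) atTop (𝓝 0) := by
  set C : ℝ≥0∞ := ∑ i, ∑ j, ‖(e i : EuclideanSpace ℝ (Fin d)) - e j‖ₑ ^ p
  have hCfin : C ≠ ∞ := by
    refine ENNReal.sum_ne_top.2 fun i _ => ENNReal.sum_ne_top.2 fun j _ => ?_
    exact ENNReal.rpow_ne_top_of_nonneg hp.le enorm_ne_top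
  have hC : ∀ i j, ‖(e i : EuclideanSpace ℝ (Fin d)) - e j‖ₑ ^ p ≤ C := fun i j =>
    (Finset.single_le_sum (f := fun j => ‖(e i : EuclideanSpace ℝ (Fin d)) - e j‖ₑ ^ p)
      (fun _ _ => zero_le) (Finset.mem_univ j)).trans
    (Finset.single_le_sum
      (f := fun i => ∑ j, ‖(e i : EuclideanSpace ℝ (Fin d)) - e j‖ₑ ^ p)
      (fun _ _ => zero_le) (Finset.mem_univ i))
  have hev : ∀ δ : ℝ≥0∞, 0 < δ → δ ≤ 1 → ∀ᶠ n in atTop, Wp p ν (νs n) ≤ (δ * C) ^ (1 / p) := by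
    intro δ hδ hδ1
    have hi : ∀ i, ∀ᶠ n in atTop, (1 - δ) * ∫⁻ x, χ i x ∂(μ : Measure Ω) ≤
        ∫⁻ x, χ i x ∂(μs n : Measure Ω) := by
      intro i
      -- A vanishing limit weight is separated because `(1 - δ) w < w` needs `w ≠ 0`.
      rcases eq_or_ne (∫⁻ x, χ i x ∂(μ : Measure Ω)) 0 with h0 | h0
      · simp [h0]
      · refine (h i).eventually_const_le ?_
        have hlt : 1 - δ < 1 := ENNReal.sub_lt_self ENNReal.one_ne_top one_ne_zero hδ.ne'
        simpa using ENNReal.mul_lt_mul_left h0 (hfin i) hlt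
    filter_upwards [eventually_all.2 hi] with n hn
    refine Wp_le_of_smul_le hp hδ1 ?_ ?_
    · rw [hν, hνs, quantize, quantize, Finset.smul_sum]
      refine Finset.sum_le_sum fun i _ => ?_
      rw [smul_smul]
      exact Measure.le_iff.2 fun s _ => by
        simp only [Measure.smul_apply, smul_eq_mul]
        exact mul_le_mul_left (hn i) _
    · rw [hν, hνs]
      exact ae_quantize (fun i => ae_quantize (fun j => hC i j) _) _
  have hlim : Tendsto (fun δ : ℝ≥0∞ => (δ * C) ^ (1 / p)) (𝓝 0) (𝓝 0) := by
    have h1 : Tendsto (fun δ : ℝ≥0∞ => δ * C) (𝓝 0) (𝓝 (0 * C)) :=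
      ENNReal.Tendsto.mul_const tendsto_id (Or.inr hCfin)
    have h2 := ((ENNReal.continuous_rpow_const (y := 1 / p)).tendsto _).comp h1
    simpa [Function.comp_def, hp] using h2
  rw [ENNReal.tendsto_nhds_zero]
  intro η hη
  have hsmall : ∀ᶠ δ in 𝓝[>] (0 : ℝ≥0∞), (δ * C) ^ (1 / p) ≤ η :=
    (hlim.mono_left nhdsWithin_le_nhds).eventually_le_const hη
  obtain ⟨δ, h1, h2, h3⟩ := (hsmall.and (eventually_mem_nhdsWithin.and
    (nhdsWithin_le_nhds (Iic_mem_nhds zero_lt_one)))).exists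
  exact (hev δ h2 h3).mono fun n hn => hn.trans h1

end Quantize

/-! ### Partitions of unity adapted to a finite set of points -/

section Partition

variable {X ι : Type*} [PseudoMetricSpace X] [Fintype ι] [Nonempty ι]

/-- The distance to a finite nonempty family of points. -/
noncomputable def minDist (e : ι → X) (x : X) : ℝ :=
  Finset.univ.inf' Finset.univ_nonempty fun i => dist x (e i)

theorem minDist_le (e : ι → X) (x : X) (i : ι) : minDist e x ≤ dist x (e i) :=
  Finset.inf'_le _ (Finset.mem_univ i)

theorem exists_minDist_eq (e : ι → X) (x : X) : ∃ i, minDist e x = dist x (e i) := by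
  obtain ⟨i, -, hi⟩ := Finset.exists_mem_eq_inf' Finset.univ_nonempty fun i => dist x (e i)
  exact ⟨i, hi⟩

theorem minDist_nonneg (e : ι → X) (x : X) : 0 ≤ minDist e x := by
  obtain ⟨i, hi⟩ := exists_minDist_eq e x
  exact hi ▸ dist_nonneg

theorem continuous_minDist (e : ι → X) : Continuous (minDist e) := by
  have h := Continuous.finset_inf' (f := fun i x => dist x (e i)) Finset.univ_nonempty
    fun i _ => (by fun_prop : Continuous fun x => dist x (e i))
  convert! h using 1
  funext x
  simp [minDist, Finset.inf'_apply]

/-- A continuous partition of unity whose members are supported near almost closest points. -/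
theorem exists_partition_minDist (e : ι → X) {ε : ℝ} (hε : 0 < ε) :
    ∃ χ : ι → X → ℝ, (∀ i, Continuous (χ i)) ∧ (∀ i x, 0 ≤ χ i x) ∧ (∀ x, ∑ i, χ i x = 1) ∧
      ∀ i x, χ i x ≠ 0 → dist x (e i) ≤ minDist e x + ε := by
  have hD := continuous_minDist e
  -- The bump `t i` is positive exactly where `e i` is within `ε` of being closest; at a closest
  -- point it equals `ε`, so the sum never vanishes.
  set t : ι → X → ℝ := fun i x => max 0 (minDist e x + ε - dist x (e i)) with ht
  have ht0 : ∀ i x, 0 ≤ t i x := fun i x => le_max_left _ _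
  have htc : ∀ i, Continuous (t i) := fun i => by fun_prop
  have hS : ∀ x, 0 < ∑ i, t i x := by
    intro x
    obtain ⟨i, hi⟩ := exists_minDist_eq e x
    refine Finset.sum_pos' (fun i _ => ht0 i x) ⟨i, Finset.mem_univ i, ?_⟩
    simp [ht, hi, hε]
  refine ⟨fun i x => t i x / ∑ j, t j x, fun i => ?_, fun i x => ?_, fun x => ?_, fun i x h => ?_⟩
  · exact (htc i).div (continuous_finsetSum _ fun j _ => htc j) fun x => (hS x).ne'
  · exact div_nonneg (ht0 i x) (hS x).le
  · rw [← Finset.sum_div, div_self (hS x).ne']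
  · have h1 : t i x ≠ 0 := fun h0 => h (by simp [h0])
    by_contra! hlt
    exact h1 (max_eq_left (by linarith))

end Partition

/-! ### From test functions of growth `p` to Wasserstein convergence -/

theorem tendsto_lintegral_of_forall_hasGrowth (hp : 0 ≤ p) {μ : ProbabilityMeasure Ω}
    {μs : ℕ → ProbabilityMeasure Ω} (hμ : moment p μ < ∞) (hμs : ∀ n, moment p (μs n) < ∞)
    (h : ∀ φ : Ω → ℝ, Continuous φ → HasGrowth p φ →
      Tendsto (fun n => ∫ x, φ x ∂(μs n : Measure Ω)) atTop (𝓝 (∫ x, φ x ∂(μ : Measure Ω))))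
    {φ : Ω → ℝ} (hc : Continuous φ) (h0 : ∀ x, 0 ≤ φ x) (hφ : HasGrowth p φ) :
    Tendsto (fun n => ∫⁻ x, ENNReal.ofReal (φ x) ∂(μs n : Measure Ω)) atTop
      (𝓝 (∫⁻ x, ENNReal.ofReal (φ x) ∂(μ : Measure Ω))) := by
  have key : ∀ ν : ProbabilityMeasure Ω, moment p ν < ∞ →
      ∫⁻ x, ENNReal.ofReal (φ x) ∂(ν : Measure Ω) = ENNReal.ofReal (∫ x, φ x ∂(ν : Measure Ω)) :=
    fun ν hν => (ofReal_integral_eq_lintegral_ofReal (hφ.integrable hp hc hν)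
      (Eventually.of_forall h0)).symm
  rw [key μ hμ]
  simp_rw [fun n => key (μs n) (hμs n)]
  exact (ENNReal.continuous_ofReal.tendsto _).comp (h φ hc hφ)

theorem hasGrowth_of_le_dist (hp : 1 ≤ p) {φ : Ω → ℝ} (h0 : ∀ x, 0 ≤ φ x) (x₀ : Ω)
    (h : ∀ x, φ x ≤ (dist x x₀ + 1) ^ p) : HasGrowth p φ := by
  have hp0 : 0 ≤ p := by linarith
  set R : ℝ := ‖(x₀ : EuclideanSpace ℝ (Fin d))‖ + 1
  have hR : 0 ≤ R := by positivity
  refine ⟨2 ^ (p - 1) * R ^ p, 2 ^ (p - 1), fun x => ?_⟩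
  rw [abs_of_nonneg (h0 x)]
  have h1 : dist x x₀ + 1 ≤ ‖(x : EuclideanSpace ℝ (Fin d))‖ + R := by
    have : dist x x₀ ≤ ‖(x : EuclideanSpace ℝ (Fin d))‖ + ‖(x₀ : EuclideanSpace ℝ (Fin d))‖ := by
      rw [Subtype.dist_eq, dist_eq_norm]
      exact norm_sub_le _ _
    simp only [R]
    linarith
  -- Convexity of `t ↦ t ^ p`, the source of the factor `2 ^ (p - 1)`.
  have h2 : (‖(x : EuclideanSpace ℝ (Fin d))‖ + R) ^ p ≤
      2 ^ (p - 1) * (‖(x : EuclideanSpace ℝ (Fin d))‖ ^ p + R ^ p) := by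
    exact_mod_cast NNReal.rpow_add_le_mul_rpow_add_rpow ‖(x : EuclideanSpace ℝ (Fin d))‖₊
      ⟨R, hR⟩ hp
  calc φ x ≤ (dist x x₀ + 1) ^ p := h x
    _ ≤ (‖(x : EuclideanSpace ℝ (Fin d))‖ + R) ^ p := by gcongr
    _ ≤ _ := h2.trans_eq (by ring)

theorem tendsto_Wp_of_forall_hasGrowth (hp : 1 ≤ p) (hΩ : MeasurableSet Ω)
    {μ : ProbabilityMeasure Ω} {μs : ℕ → ProbabilityMeasure Ω}
    (hμ : moment p μ < ∞) (hμs : ∀ n, moment p (μs n) < ∞)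
    (h : ∀ φ : Ω → ℝ, Continuous φ → HasGrowth p φ →
      Tendsto (fun n => ∫ x, φ x ∂(μs n : Measure Ω)) atTop (𝓝 (∫ x, φ x ∂(μ : Measure Ω)))) :
    Tendsto (fun n => Wp p (μs n) μ) atTop (𝓝 0) := by
  have hp0 : 0 < p := by linarith
  have : Nonempty Ω := μ.nonempty
  -- With `N + 1` points every net is nonempty and contains `x₀`, the point of index `0`. This
  -- yields the bound `(dist x x₀ + 1) ^ p` on `D N`, uniform in `N`, used for dominated
  -- convergence.
  let e : ∀ N : ℕ, Fin (N + 1) → Ω := fun N i => TopologicalSpace.denseSeq Ω i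
  let ε : ℕ → ℝ := fun N => 1 / ((N : ℝ) + 1)
  have hε : ∀ N, 0 < ε N := fun N => Nat.one_div_pos_of_nat
  have hε1 : ∀ N, ε N ≤ 1 := fun N => by
    simpa [ε] using inv_le_one_of_one_le₀ (by linarith [N.cast_nonneg (α := ℝ)] : 1 ≤ (N : ℝ) + 1)
  let D : ℕ → Ω → ℝ := fun N x => (minDist (e N) x + ε N) ^ p
  have hb0 : ∀ N x, 0 ≤ minDist (e N) x + ε N := fun N x =>
    add_nonneg (minDist_nonneg _ _) (hε N).le
  have hD0 : ∀ N x, 0 ≤ D N x := fun N x => Real.rpow_nonneg (hb0 N x) _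
  have hDc : ∀ N, Continuous (D N) := fun N =>
    ((continuous_minDist _).add continuous_const).rpow_const fun _ => Or.inr hp0.le
  set x₀ : Ω := TopologicalSpace.denseSeq Ω 0
  have hDle : ∀ N x, D N x ≤ (dist x x₀ + 1) ^ p := fun N x =>
    Real.rpow_le_rpow (hb0 N x) (add_le_add (minDist_le (e N) x 0) (hε1 N)) hp0.le
  have hDG : ∀ N, HasGrowth p (D N) := fun N => hasGrowth_of_le_dist hp (hD0 N) x₀ (hDle N)
  have hDint : Tendsto (fun N => (∫⁻ x, ENNReal.ofReal (D N x) ∂(μ : Measure Ω)) ^ (1 / p)) atTop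
      (𝓝 0) := by
    have hbc : Continuous fun x : Ω => (dist x x₀ + 1) ^ p :=
      (by fun_prop : Continuous fun x : Ω => dist x x₀ + 1).rpow_const fun _ => Or.inr hp0.le
    have hbG : HasGrowth p fun x : Ω => (dist x x₀ + 1) ^ p :=
      hasGrowth_of_le_dist hp (fun x => by positivity) x₀ fun x => le_rfl
    have hbi := (hbG.integrable hp0.le hbc hμ).lintegral_lt_top
    have hlim : Tendsto (fun N => ∫⁻ x, ENNReal.ofReal (D N x) ∂(μ : Measure Ω)) atTop
        (𝓝 (∫⁻ _, 0 ∂(μ : Measure Ω))) := by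
      refine tendsto_lintegral_of_dominated_convergence
        (fun x => ENNReal.ofReal ((dist x x₀ + 1) ^ p)) (fun N => (hDc N).measurable.ennreal_ofReal)
        (fun N => Eventually.of_forall fun x => ENNReal.ofReal_le_ofReal (hDle N x)) hbi.ne
        (Eventually.of_forall fun x => ?_)
      have h1 : Tendsto (fun N => minDist (e N) x) atTop (𝓝 0) := by
        rw [Metric.tendsto_atTop]
        intro η hη
        obtain ⟨k, hk⟩ := (TopologicalSpace.denseRange_denseSeq Ω).exists_dist_lt x hη
        refine ⟨k, fun N hN => ?_⟩
        rw [Real.dist_0_eq_abs, abs_of_nonneg (minDist_nonneg _ _)]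
        exact (minDist_le (e N) x ⟨k, by omega⟩).trans_lt hk
      have h2 : Tendsto (fun N => D N x) atTop (𝓝 0) := by
        have h3 := (h1.add tendsto_one_div_add_atTop_nhds_zero_nat).rpow_const
          (p := p) (Or.inr hp0.le)
        simpa [D, ε, hp0.ne'] using h3
      simpa [Function.comp_def] using (ENNReal.continuous_ofReal.tendsto _).comp h2
    have h4 := ((ENNReal.continuous_rpow_const (y := 1 / p)).tendsto _).comp hlim
    simpa [Function.comp_def, hp0] using h4
  rw [ENNReal.tendsto_nhds_zero]
  intro η hη
  have hη3 : 0 < η / 3 := ENNReal.div_pos hη.ne' (by simp)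
  -- The net is chosen from `μ` alone and then fixed; the convergence of the integrals of `D N`
  -- carries the strict bound `η / 3` over to `μs n` for large `n`.
  obtain ⟨N, hN⟩ := (hDint.eventually_lt_const hη3).exists
  obtain ⟨χ, hχc, hχ0, hχ1, hχD⟩ := exists_partition_minDist (e N) (hε N)
  have hχm : ∀ i, Measurable fun x => ENNReal.ofReal (χ i x) := fun i =>
    (hχc i).measurable.ennreal_ofReal
  have hχsum : ∀ x, ∑ i, ENNReal.ofReal (χ i x) = 1 := fun x => by
    rw [← ENNReal.ofReal_sum_of_nonneg fun i _ => hχ0 i x, hχ1, ENNReal.ofReal_one]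
  have hχle : ∀ i x, χ i x ≤ 1 := fun i x => by
    rw [← hχ1 x]
    exact Finset.single_le_sum (f := fun i => χ i x) (fun j _ => hχ0 j x) (Finset.mem_univ i)
  have hχG : ∀ i, HasGrowth p (χ i) := fun i =>
    ⟨1, 0, fun x => by simpa [abs_of_nonneg (hχ0 i x)] using hχle i x⟩
  have hχcost : ∀ i x, ENNReal.ofReal (χ i x) ≠ 0 →
      ‖(x : EuclideanSpace ℝ (Fin d)) - e N i‖ₑ ^ p ≤ ENNReal.ofReal (D N x) := by
    intro i x hi
    have hd := hχD i x fun h0 => hi (by simp [h0])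
    rw [Subtype.dist_eq, dist_eq_norm] at hd
    rw [← ofReal_norm, ENNReal.ofReal_rpow_of_nonneg (norm_nonneg _) hp0.le]
    exact ENNReal.ofReal_le_ofReal (Real.rpow_le_rpow (norm_nonneg _) hd hp0.le)
  let Q : ProbabilityMeasure Ω → ProbabilityMeasure Ω := fun ν =>
    ⟨quantize (fun i x => ENNReal.ofReal (χ i x)) (e N) ν,
      isProbabilityMeasure_quantize hχm hχsum (e N) ν⟩
  have hQ : ∀ ν, Wp p ν (Q ν) ≤ (∫⁻ x, ENNReal.ofReal (D N x) ∂(ν : Measure Ω)) ^ (1 / p) :=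
    fun ν => Wp_quantize_le hp0 hχm hχsum (hDc N).measurable.ennreal_ofReal hχcost rfl
  have hQt : Tendsto (fun n => Wp p (Q μ) (Q (μs n))) atTop (𝓝 0) :=
    tendsto_Wp_quantize hp0 rfl (fun _ => rfl)
      (fun i => ((hχG i).integrable hp0.le (hχc i) hμ).lintegral_lt_top.ne)
      fun i => tendsto_lintegral_of_forall_hasGrowth hp0.le hμ hμs h (hχc i) (hχ0 i) (hχG i)
  have hDt : Tendsto (fun n => (∫⁻ x, ENNReal.ofReal (D N x) ∂(μs n : Measure Ω)) ^ (1 / p)) atTop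
      (𝓝 ((∫⁻ x, ENNReal.ofReal (D N x) ∂(μ : Measure Ω)) ^ (1 / p))) :=
    ((ENNReal.continuous_rpow_const (y := 1 / p)).tendsto _).comp
      (tendsto_lintegral_of_forall_hasGrowth hp0.le hμ hμs h (hDc N) (hD0 N) (hDG N))
  filter_upwards [hDt.eventually_lt_const hN, hQt.eventually_lt_const hη3] with n h1 h2
  calc Wp p (μs n) μ ≤ Wp p (μs n) (Q (μs n)) + Wp p (Q (μs n)) μ := Wp_triangle hp hΩ _ _ _
    _ ≤ Wp p (μs n) (Q (μs n)) + (Wp p (Q (μs n)) (Q μ) + Wp p (Q μ) μ) := by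
        gcongr
        exact Wp_triangle hp hΩ _ _ _
    _ ≤ η / 3 + (η / 3 + η / 3) := by
        rw [Wp_comm hp0 hΩ (Q (μs n)), Wp_comm hp0 hΩ (Q μ) μ]
        exact add_le_add ((hQ _).trans h1.le) (add_le_add h2.le ((hQ _).trans hN.le))
    _ = η := by rw [← add_assoc, ENNReal.add_thirds]

end OptimalTransport

theorem mainTheorem3 (d : ℕ) (Ω : Set (EuclideanSpace ℝ (Fin d))) (hΩ : MeasurableSet Ω)
    (p : ℝ) (hp : 1 ≤ p) :
    -- the minimum in the definition of `W_p` is attained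
    (∀ μ ν : ProbabilityMeasure Ω, ∃ γ, OptimalTransport.IsOptimalPlan p μ ν γ) ∧
    -- `W_p` is a (finite) distance on the measures with finite `p`-th moment
    (∀ μ ∈ OptimalTransport.finiteMoment p Ω, ∀ ν ∈ OptimalTransport.finiteMoment p Ω,
      OptimalTransport.Wp p μ ν < ∞) ∧
    (∀ μ ∈ OptimalTransport.finiteMoment p Ω, ∀ ν ∈ OptimalTransport.finiteMoment p Ω,
      (OptimalTransport.Wp p μ ν = 0 ↔ μ = ν)) ∧
    (∀ μ ∈ OptimalTransport.finiteMoment p Ω, ∀ ν ∈ OptimalTransport.finiteMoment p Ω,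
      OptimalTransport.Wp p μ ν = OptimalTransport.Wp p ν μ) ∧
    (∀ μ ∈ OptimalTransport.finiteMoment p Ω, ∀ ν ∈ OptimalTransport.finiteMoment p Ω,
      ∀ ρ ∈ OptimalTransport.finiteMoment p Ω,
        OptimalTransport.Wp p μ ρ ≤ OptimalTransport.Wp p μ ν + OptimalTransport.Wp p ν ρ) ∧
    -- characterizations of convergence
    (∀ μ ∈ OptimalTransport.finiteMoment p Ω, ∀ μs : ℕ → ProbabilityMeasure Ω,
      (∀ n, μs n ∈ OptimalTransport.finiteMoment p Ω) →
        List.TFAE [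
          Tendsto (fun n => OptimalTransport.Wp p (μs n) μ) atTop (𝓝 0),
          Tendsto μs atTop (𝓝 μ) ∧
            Tendsto (fun n => OptimalTransport.moment p (μs n)) atTop
              (𝓝 (OptimalTransport.moment p μ)),
          ∀ φ : Ω → ℝ, Continuous φ → OptimalTransport.HasGrowth p φ →
            Tendsto (fun n => ∫ x, φ x ∂(μs n : Measure Ω)) atTop
              (𝓝 (∫ x, φ x ∂(μ : Measure Ω)))]) := by
  have hp0 : 0 < p := by linarith
  refine ⟨OptimalTransport.exists_isOptimalPlan hΩ hp0.le,
    fun μ hμ ν hν => OptimalTransport.Wp_lt_top hp hμ hν,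
    fun μ _ ν _ => ⟨OptimalTransport.eq_of_Wp_eq_zero hp0 hΩ, ?_⟩,
    fun μ _ ν _ => OptimalTransport.Wp_comm hp0 hΩ μ ν,
    fun μ _ ν _ ρ _ => OptimalTransport.Wp_triangle hp hΩ μ ν ρ, fun μ hμ μs hμs => ?_⟩
  · rintro rfl
    exact OptimalTransport.Wp_self hp0 μ
  · tfae_have 1 → 2 := fun h => ⟨OptimalTransport.tendsto_of_tendsto_Wp hp hΩ h,
      OptimalTransport.tendsto_moment_of_tendsto_Wp hp hΩ h⟩
    tfae_have 2 → 3 := fun h φ hc hφ =>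
      OptimalTransport.tendsto_integral_of_hasGrowth hp0.le hμ hμs h.1 h.2 hc hφ
    tfae_have 3 → 1 := fun h => OptimalTransport.tendsto_Wp_of_forall_hasGrowth hp hΩ hμ hμs h
    tfae_finish
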